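/- Let $\mathcal H$ be a complex Hilbert space and $\mathbb L(\mathcal H)$ the lattice of its closed subspaces, with $U\wedge V=U\cap V$, $U\vee V=\overline{U+V}$ and the orthogonal complement $U^\perp$; let $P_U$ be the orthogonal projection onto $U$. A *Boolean sector* $\mathbb B$ is a subset of $\mathbb L(\mathcal H)$ that contains $0$ and $\mathcal H$, is closed under $\wedge,\vee,{}^\perp$, is distributive, and is maximal with these properties. $C^*(\mathbb B)$ is the $C^*$-algebra generated by $\{P_U\mid U\in\mathbb B\}$. It is commutative; let $\Omega_{\mathbb B}$ be its Gelfand spectrum. A *quasipoint* of $\mathbb B$ is a maximal element among the nonempty sets $\beta\subseteq\mathbb B$ such that $0\notin\beta$ and any $U,V\in\beta$ admit $W\in\beta$ with $W\subseteq U\cap V$. $\mathcal Q(\mathbb B)$ is the set of quasipoints, with the topology whose basis is formed by the sets $\mathcal Q_U(\mathbb B)=\{\beta\mid U\in\beta\}$, $U\in\mathbb B$. A *spectral family* is a map $\sigma:\mathbb R\to\mathbb L(\mathcal H)$ that is increasing, with $\sigma(\lambda)=\bigcap_{\mu>\lambda}\sigma(\mu)$ for all $\lambda$, $\bigcap_\lambda\sigma(\lambda)=0$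 and $\bigvee_\lambda\sigma(\lambda)=\mathcal H$. For a bounded self-adjoint operator $A$, $\sigma_A$ is the unique spectral family with $\sigma_A(a)=0$, $\sigma_A(b)=\mathcal H$ for some $a\le b$ and $A=\int_a^b\lambda\,dP_{\sigma_A(\lambda)}$ (norm-convergent Riemann–Stieltjes integral). Put $$f_A^{\mathbb B}:\mathcal Q(\mathbb B)\to\mathbb R,\qquad f_A^{\mathbb B}(\beta)=\inf\{\lambda\in\mathbb R\mid\sigma_A(\lambda)\in\beta\}.$$ **Theorem.** Let $\mathbb B$ be a Boolean sector of $\mathbb L(\mathcal H)$. 1. For every self-adjoint $A\in C^*(\mathbb B)$ the spectral family $\sigma_A$ exists and is unique, and $f_A^{\mathbb B}$ is continuous. 2. There is a unique homeomorphism $\mathcal Q(\mathbb B)\to\Omega_{\mathbb B}$, $\beta\mapsto\tau_\beta$, such that $\tau_\beta(P_U)=1$ if $U\in\beta$ and $\tau_\beta(P_U)=0$ if $U\in\mathbb B\setminus\beta$. 3. The map $A\mapsto f_A^{\mathbb B}$ on the self-adjoint part $C^*(\mathbb B)_{sa}$ is the restriction of the Gelfand transform $\mathcal F_{\mathbb B}:C^*(\mathbb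 B)\to C(\mathcal Q(\mathbb B))$, $\mathcal F_{\mathbb B}(A)(\beta)=\tau_\beta(A)$; that is, $f_A^{\mathbb B}(\beta)=\tau_\beta(A)$ for all self-adjoint $A\in C^*(\mathbb B)$ and all $\beta\in\mathcal Q(\mathbb B)$. -/

import Mathlib

open Set Filter Topology

noncomputable section

/-! ### Quasipoints and the Stonean space of a lattice -/

section Quasipoints

variable (L : Type*) [Lattice L] [BoundedOrder L]

/-- A filter basis in a bounded lattice. -/
structure IsFilterBasisIn {L : Type*} [Lattice L] [BoundedOrder L] (b : Set L) : Prop where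
  nonempty : b.Nonempty
  bot_notMem : ⊥ ∉ b
  directed : ∀ x ∈ b, ∀ y ∈ b, ∃ z ∈ b, z ≤ x ⊓ y

/-- A quasipoint of a bounded lattice: a maximal filter basis. -/
structure Quasipoint where
  carrier : Set L
  maximal' : Maximal IsFilterBasisIn carrier

variable {L}

instance : Membership L (Quasipoint L) := ⟨fun β U => U ∈ β.carrier⟩

/-- The set of all quasipoints that contain `U`. -/
def Quasipoint.basicOpen (U : L) : Set (Quasipoint L) := {β | U ∈ β}

/-- The topology of the Stonean space, generated by the sets of quasipoints containing a given
element of the lattice (these sets form a basis, as they are stable under finite intersections). -/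
instance : TopologicalSpace (Quasipoint L) :=
  TopologicalSpace.generateFrom (Set.range (Quasipoint.basicOpen (L := L)))

end Quasipoints

section Hilbert

variable (H : Type*) [NormedAddCommGroup H] [InnerProductSpace ℂ H] [CompleteSpace H]

/-- The quantum lattice: the closed subspaces of the Hilbert space, with intersection, closure of
the sum, and orthogonal complement. -/
abbrev QuantumLattice := ClosedSubmodule ℂ H

variable {H}

/-- The orthogonal projection onto a closed subspace, as a bounded operator on `H`. -/
def orthProj (U : QuantumLattice H) : H →L[ℂ] H := U.toSubmodule.starProjection

/-! ### Boolean sectors -/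

variable (H) in
/-- A sublattice of the orthocomplemented lattice of closed subspaces: it contains `0` and `H` and is
closed under the three lattice operations `∧`, `∨` and `⊥`. -/
structure OrthoSublattice extends Sublattice (QuantumLattice H) where
  bot_mem' : ⊥ ∈ carrier
  top_mem' : ⊤ ∈ carrier
  orthogonal_mem' : ∀ U ∈ carrier, U.orthogonal ∈ carrier

instance : SetLike (OrthoSublattice H) (QuantumLattice H) where
  coe D := D.carrier
  coe_injective := by
    rintro ⟨⟨c, _, _⟩, _, _, _⟩ ⟨⟨c', _, _⟩, _, _, _⟩ h
    congr

instance : PartialOrder (OrthoSublattice H) := PartialOrder.ofSetLike _ _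

instance (D : OrthoSublattice H) : Lattice D :=
  inferInstanceAs (Lattice D.toSublattice)

instance (D : OrthoSublattice H) : BoundedOrder D where
  top := ⟨⊤, D.top_mem'⟩
  le_top U := show (U : QuantumLattice H) ≤ ⊤ from le_top
  bot := ⟨⊥, D.bot_mem'⟩
  bot_le U := show (⊥ : QuantumLattice H) ≤ U from bot_le

/-- Both distributive laws hold in `D`. -/
def OrthoSublattice.IsDistributive (D : OrthoSublattice H) : Prop :=
  (∀ U V W : D, U ⊓ (V ⊔ W) = (U ⊓ V) ⊔ (U ⊓ W)) ∧
    ∀ U V W : D, U ⊔ (V ⊓ W) = (U ⊔ V) ⊓ (U ⊔ W)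

variable (H) in
/-- A Boolean sector: a maximal distributive sublattice of the orthocomplemented lattice of closed
subspaces of `H`. -/
structure BooleanSector where
  lattice : OrthoSublattice H
  maximal' : Maximal OrthoSublattice.IsDistributive lattice

instance : CoeSort (BooleanSector H) (Type _) := ⟨fun B => B.lattice⟩

/-! ### The C⋆-algebra of a Boolean sector -/

/-- The C⋆-algebra generated by the orthogonal projections onto the elements of a Boolean
sector. -/
def BooleanSector.cstar (B : BooleanSector H) : StarSubalgebra ℂ (H →L[ℂ] H) :=
  (StarAlgebra.adjoin ℂ (orthProj '' (B.lattice : Set (QuantumLattice H)))).topologicalClosure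

/-- The projection onto an element of a Boolean sector, as an element of its C⋆-algebra. -/
def BooleanSector.proj (B : BooleanSector H) (U : B) : B.cstar :=
  ⟨orthProj U.1, StarSubalgebra.le_topologicalClosure _
    (StarAlgebra.subset_adjoin ℂ _ ⟨U.1, U.2, rfl⟩)⟩

theorem orthProj_mem_of_distrib {U V : QuantumLattice H}
    (h : U ⊓ (V ⊔ V.orthogonal) = (U ⊓ V) ⊔ (U ⊓ V.orthogonal)) (x : H) (hx : x ∈ U) :
    orthProj V x ∈ U := by
  have htop : V ⊔ V.orthogonal = ⊤ := by
    refine top_unique fun y _ => ?_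
    have h1 : orthProj V y ∈ V ⊔ V.orthogonal :=
      (le_sup_left : V ≤ V ⊔ V.orthogonal) (Submodule.starProjection_apply_mem V.toSubmodule y)
    have h2 : y - orthProj V y ∈ V ⊔ V.orthogonal :=
      (le_sup_right : V.orthogonal ≤ V ⊔ V.orthogonal)
        (Submodule.sub_starProjection_mem_orthogonal (K := V.toSubmodule) y)
    simpa using add_mem h1 h2
  have hle : (U ⊓ V) ⊔ (U ⊓ V.orthogonal) ≤ U.comap (orthProj V) := by
    refine sup_le ?_ ?_
    · rintro y ⟨hyU, hyV⟩
      have : orthProj V y = y := Submodule.starProjection_eq_self_iff.2 hyV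
      show orthProj V y ∈ U
      rw [this]; exact hyU
    · rintro y ⟨_, hyV⟩
      have : orthProj V y = 0 := (Submodule.starProjection_apply_eq_zero_iff _).2 hyV
      show orthProj V y ∈ U
      rw [this]; exact zero_mem U
  rw [htop, inf_top_eq] at h
  exact hle (h ▸ hx)

theorem BooleanSector.orthProj_comm (B : BooleanSector H) {U V : QuantumLattice H}
    (hU : U ∈ B.lattice) (hV : V ∈ B.lattice) :
    orthProj U * orthProj V = orthProj V * orthProj U := by
  have hd := congrArg Subtype.val (B.maximal'.1.1 ⟨U, hU⟩ ⟨V, hV⟩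
    ⟨V.orthogonal, B.lattice.orthogonal_mem' V hV⟩)
  have key : orthProj U * (orthProj V * orthProj U) = orthProj V * orthProj U := by
    ext x
    exact Submodule.starProjection_eq_self_iff.2
      (orthProj_mem_of_distrib hd _ (Submodule.starProjection_apply_mem U.toSubmodule x))
  have hsa : ∀ W : QuantumLattice H, star (orthProj W) = orthProj W := fun W =>
    isSelfAdjoint_starProjection W.toSubmodule
  have key' := congrArg star key
  simp only [star_mul, hsa] at key'
  rw [← key', mul_assoc, key]

instance BooleanSector.isClosed_cstar (B : BooleanSector H) :
    IsClosed (B.cstar : Set (H →L[ℂ] H)) :=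
  StarSubalgebra.isClosed_topologicalClosure _

theorem BooleanSector.cstar_comm (B : BooleanSector H) (x y : B.cstar) : x * y = y * x := by
  have hc : ∀ a ∈ orthProj '' (B.lattice : Set (QuantumLattice H)),
      ∀ b ∈ orthProj '' (B.lattice : Set (QuantumLattice H)), a * b = b * a := by
    rintro _ ⟨U, hU, rfl⟩ _ ⟨V, hV, rfl⟩
    exact B.orthProj_comm hU hV
  have hs : ∀ a ∈ orthProj '' (B.lattice : Set (QuantumLattice H)),
      ∀ b ∈ orthProj '' (B.lattice : Set (QuantumLattice H)), a * star b = star b * a := by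
    rintro _ ⟨U, hU, rfl⟩ _ ⟨V, hV, rfl⟩
    have hV' : star (orthProj V) = orthProj V := isSelfAdjoint_starProjection V.toSubmodule
    rw [hV']
    exact B.orthProj_comm hU hV
  have := StarAlgebra.isMulCommutative_adjoin ℂ hc hs
  let _ := StarSubalgebra.commSemiringTopologicalClosure
    (StarAlgebra.adjoin ℂ (orthProj '' (B.lattice : Set (QuantumLattice H))))
    (fun a b => mul_comm' a b)
  exact mul_comm (G := (StarAlgebra.adjoin ℂ
    (orthProj '' (B.lattice : Set (QuantumLattice H)))).topologicalClosure) x y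

instance (B : BooleanSector H) : CommCStarAlgebra B.cstar where
  __ := StarSubalgebra.cstarAlgebra B.cstar
  mul_comm := B.cstar_comm

/-! ### Spectral families and observable functions -/

/-- A spectral family in the quantum lattice. -/
structure IsSpectralFamily (σ : ℝ → QuantumLattice H) : Prop where
  mono : Monotone σ
  right_cont : ∀ t, σ t = ⨅ s, ⨅ _ : t < s, σ s
  iInf_eq_bot : ⨅ t, σ t = ⊥
  iSup_eq_top : ⨆ t, σ t = ⊤

/-- `A` is the Riemann–Stieltjes integral over `[a, b]` of `t` with respect to the projections onto
`σ t`: the Riemann–Stieltjes sums converge to `A` in the operator norm as the mesh of the tagged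
partition `a = t₀ ≤ t₁ ≤ ⋯ ≤ tₙ = b` tends to zero. -/
def IsRiemannStieltjesIntegral (σ : ℝ → QuantumLattice H) (a b : ℝ) (A : H →L[ℂ] H) : Prop :=
  ∀ ε > 0, ∃ δ > 0, ∀ (n : ℕ) (t ξ : ℕ → ℝ), Monotone t → t 0 = a → t n = b →
    (∀ k < n, t (k + 1) - t k < δ) → (∀ k < n, ξ k ∈ Icc (t k) (t (k + 1))) →
    ‖A - ∑ k ∈ Finset.range n,
      (ξ k : ℂ) • (orthProj (σ (t (k + 1))) - orthProj (σ (t k)))‖ < ε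

/-- `σ` is the spectral family of the bounded operator `A`: it is a spectral family that goes from
`0` to `H` on a compact interval `[a, b]`, and `A = ∫ t d P_{σ t}` over that interval, hence over
the whole line. -/
def IsSpectralFamilyOf (σ : ℝ → QuantumLattice H) (A : H →L[ℂ] H) : Prop :=
  IsSpectralFamily σ ∧
    ∃ a b : ℝ, a ≤ b ∧ σ a = ⊥ ∧ σ b = ⊤ ∧ IsRiemannStieltjesIntegral σ a b A

open Classical in
/-- The spectral family of a bounded operator (meaningful when there is exactly one, which is the
case for self-adjoint operators). -/
def spectralFamily (A : H →L[ℂ] H) : ℝ → QuantumLattice H :=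
  if h : ∃ σ, IsSpectralFamilyOf σ A then h.choose else fun _ => ⊥

/-- The function on the Stonean space of a Boolean sector that is induced by `A`: its value at `β`
is the infimum of all `t` such that `σ_A t` belongs to `β`. -/
def BooleanSector.observable (B : BooleanSector H) (A : H →L[ℂ] H) (β : Quasipoint B) : ℝ :=
  sInf {t : ℝ | ∃ h : spectralFamily A t ∈ B.lattice,
    (⟨spectralFamily A t, h⟩ : B.lattice) ∈ β}

/-! ### The Gelfand transform on the Stonean space -/

/-- `τ` identifies the quasipoint `β` with the character `τ_β` of the C⋆-algebra of the sector that
is `1` on the projections onto the elements of `β` and `0` on those onto the other elements of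
the sector. -/
def BooleanSector.IsCanonical (B : BooleanSector H)
    (τ : Quasipoint B ≃ₜ WeakDual.characterSpace ℂ B.cstar) : Prop :=
  ∀ (β : Quasipoint B) (U : B),
    (U ∈ β → τ β (B.proj U) = 1) ∧ (U ∉ β → τ β (B.proj U) = 0)

/-- The Gelfand transform, read as a map onto the continuous functions on the Stonean space by means
of an identification `τ` of that space with the Gelfand spectrum. -/
def BooleanSector.gelfand (B : BooleanSector H)
    (τ : Quasipoint B ≃ₜ WeakDual.characterSpace ℂ B.cstar) :
    B.cstar ≃⋆ₐ[ℂ] C(Quasipoint B, ℂ) :=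
  (gelfandStarTransform B.cstar).trans (τ.compStarAlgEquiv' ℂ ℂ)

end Hilbert

end

/-!
The C⋆-algebra of a Boolean sector `B` is commutative, so it is studied through its characters: they
compute the C⋆-norm (`norm_le_of_forall_character`) and satisfy `τ (f(A)) = f(τ A)`
(`character_cfc`), and each takes only the values `0` and `1` on the projections of `B`.

*Stonean space.* A character `τ` gives the quasipoint `{U | τ (P_U) = 1}`. This map is injective, as
the projections generate the algebra, and continuous. It is surjective by compactness of the Gelfand
spectrum: for a quasipoint `β` the closed sets `{τ | τ (P_U) = 1}`, `U ∈ β`, are directed, and they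
are nonempty because `P_U ≠ 0`. Since the Stonean space is Hausdorff, the map is a homeomorphism,
and its inverse is the required one (`BooleanSector.quasipointHomeomorph`).

*Existence of the spectral family.* Let `σ t` be the kernel of the positive part of `A - t`. Its
projection commutes with every operator commuting with `A`, and maximality puts every closed subspace
whose projection commutes with those of `B` into `B` (`BooleanSector.mem_lattice_of_commute`); so
`σ t ∈ B`. Moreover `τ A ≤ t` if `τ (P_{σ t}) = 1`, and `t ≤ τ A` if `τ (P_{σ t}) = 0`. Hence each
character sends a Riemann–Stieltjes sum to the tag of the one interval where `τ (P_{σ t})` jumps,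
which is within the mesh of `τ A`; as the characters compute the norm, the sums converge to `A`.

*Uniqueness.* Any spectral family `σ'` of `A` commutes with `A`, hence with `σ`, and both satisfy
`⟪x, A x⟫ ≤ t ‖x‖ ^ 2` on the subspace at `t` and the reverse inequality on its orthogonal
complement. So the part of `σ s` orthogonal to `σ' t` is zero for `s < t`, that is `σ s ≤ σ' t`, and
right continuity gives `σ s ≤ σ' s`; the roles can be exchanged (`IsSpectralFamilyOf.eq_of_commute`).

*Gelfand transform.* By the two inequalities for `τ A`, the set of all `t` with `σ t ∈ β` contains
every `t > τ_β A` and no `t < τ_β A`; its infimum is `τ_β A`. Continuity of `β ↦ τ_β A` then gives the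
continuity of the observable function.
-/

noncomputable section

/-! ### Projections onto closed subspaces -/

section Projections

variable {H : Type*} [NormedAddCommGroup H] [InnerProductSpace ℂ H] [CompleteSpace H]

theorem orthProj_apply_mem (U : QuantumLattice H) (x : H) : orthProj U x ∈ U :=
  Submodule.starProjection_apply_mem U.toSubmodule x

theorem orthProj_eq_self_iff {U : QuantumLattice H} {x : H} : orthProj U x = x ↔ x ∈ U :=
  Submodule.starProjection_eq_self_iff

theorem isSelfAdjoint_orthProj (U : QuantumLattice H) : IsSelfAdjoint (orthProj U) :=
  isSelfAdjoint_starProjection U.toSubmodule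

theorem orthProj_mul_self (U : QuantumLattice H) : orthProj U * orthProj U = orthProj U :=
  Submodule.isIdempotentElem_starProjection U.toSubmodule

theorem orthProj_injective : Function.Injective (orthProj (H := H)) := by
  intro U V h
  ext x
  change x ∈ U ↔ x ∈ V
  rw [← orthProj_eq_self_iff, h, orthProj_eq_self_iff]

theorem orthProj_bot : orthProj (⊥ : QuantumLattice H) = 0 := by
  ext x
  exact orthProj_apply_mem ⊥ x

theorem orthProj_top : orthProj (⊤ : QuantumLattice H) = 1 := by
  ext x
  exact orthProj_eq_self_iff.2 (ClosedSubmodule.mem_top)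

theorem orthProj_orthogonal (U : QuantumLattice H) : orthProj U.orthogonal = 1 - orthProj U :=
  Submodule.starProjection_orthogonal' U.toSubmodule

theorem le_iff_orthProj_mul_eq {U V : QuantumLattice H} :
    U ≤ V ↔ orthProj V * orthProj U = orthProj U := by
  constructor
  · intro h
    ext x
    exact orthProj_eq_self_iff.2 (h (orthProj_apply_mem U x))
  · intro h x hx
    have := congrArg (fun T : H →L[ℂ] H => T x) h
    simp only [mul_apply_eq_comp, orthProj_eq_self_iff.2 hx] at this
    exact orthProj_eq_self_iff.1 this

theorem orthProj_mul_of_le {U V : QuantumLattice H} (h : U ≤ V) :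
    orthProj U * orthProj V = orthProj U := by
  have := congrArg star (le_iff_orthProj_mul_eq.1 h)
  simpa only [star_mul, (isSelfAdjoint_orthProj _).star_eq] using this

theorem norm_orthProj_apply_le_of_le {U V : QuantumLattice H} (h : U ≤ V) (x : H) :
    ‖orthProj U x‖ ≤ ‖orthProj V x‖ := by
  rw [← orthProj_mul_of_le h]
  exact Submodule.norm_starProjection_apply_le U.toSubmodule _

theorem orthProj_commute_of_monotone {σ : ℝ → QuantumLattice H} (hσ : Monotone σ) (s t : ℝ) :
    Commute (orthProj (σ s)) (orthProj (σ t)) := by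
  rcases le_total s t with h | h
  · rw [commute_iff_eq, orthProj_mul_of_le (hσ h), le_iff_orthProj_mul_eq.1 (hσ h)]
  · rw [commute_iff_eq, orthProj_mul_of_le (hσ h), le_iff_orthProj_mul_eq.1 (hσ h)]

theorem re_inner_orthProj (U : QuantumLattice H) (x : H) :
    (inner ℂ x (orthProj U x)).re = ‖orthProj U x‖ ^ 2 := by
  have := Submodule.re_inner_starProjection_eq_normSq U.toSubmodule x
  rw [← inner_conj_symm, Complex.conj_re]
  exact this

theorem orthProj_inf_of_commute {U V : QuantumLattice H}
    (h : orthProj U * orthProj V = orthProj V * orthProj U) :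
    orthProj (U ⊓ V) = orthProj U * orthProj V := by
  have hU : orthProj U * orthProj (U ⊓ V) = orthProj (U ⊓ V) :=
    le_iff_orthProj_mul_eq.1 inf_le_left
  have hV : orthProj V * orthProj (U ⊓ V) = orthProj (U ⊓ V) :=
    le_iff_orthProj_mul_eq.1 inf_le_right
  have hUV : orthProj (U ⊓ V) * (orthProj U * orthProj V) = orthProj U * orthProj V := by
    ext x
    refine orthProj_eq_self_iff.2 ⟨orthProj_apply_mem U _, ?_⟩
    rw [h]
    exact orthProj_apply_mem V _
  have := congrArg star hUV
  simp only [star_mul, (isSelfAdjoint_orthProj _).star_eq] at this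
  rw [mul_assoc, hU, hV] at this
  rw [this, h]

theorem orthProj_sup_of_commute {U V : QuantumLattice H}
    (h : orthProj U * orthProj V = orthProj V * orthProj U) :
    orthProj (U ⊔ V) = orthProj U + orthProj V - orthProj U * orthProj V := by
  have key : (U ⊔ V).orthogonal = U.orthogonal ⊓ V.orthogonal  :=
    (ClosedSubmodule.inf_orthogonal U V).symm
  have h' : orthProj U.orthogonal * orthProj V.orthogonal =
      orthProj V.orthogonal * orthProj U.orthogonal := by
    simp only [orthProj_orthogonal, mul_sub, sub_mul, one_mul, mul_one, h]
    abel
  have h2 := orthProj_inf_of_commute h'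
  rw [← key] at h2
  simp only [orthProj_orthogonal, mul_sub, sub_mul, one_mul, mul_one] at h2
  rw [← sub_eq_zero] at h2 ⊢
  rw [← neg_eq_zero, ← h2]
  abel

theorem commute_orthProj_of_isSelfAdjoint {U : QuantumLattice H} {T : H →L[ℂ] H}
    (hT : IsSelfAdjoint T) (h : ∀ x ∈ U, T x ∈ U) : Commute T (orthProj U) := by
  have key : orthProj U * (T * orthProj U) = T * orthProj U := by
    ext x
    exact orthProj_eq_self_iff.2 (h _ (orthProj_apply_mem U x))
  have key' := congrArg star key
  simp only [star_mul, (isSelfAdjoint_orthProj _).star_eq, hT.star_eq] at key'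
  rw [commute_iff_eq, ← key, ← key', mul_assoc]

/-- The closed subspaces whose projections lie in a commutative ring of operators. A subring
suffices, as the lattice operations on commuting projections are polynomials with integer
coefficients. -/
def OrthoSublattice.ofCommutative (R : Subring (H →L[ℂ] H)) (hR : ∀ x ∈ R, ∀ y ∈ R, x * y = y * x) :
    OrthoSublattice H where
  carrier := {W | orthProj W ∈ R}
  supClosed' := by
    intro U hU V hV
    rw [mem_ofPred_eq, orthProj_sup_of_commute (hR _ hU _ hV)]
    exact sub_mem (add_mem hU hV) (mul_mem hU hV)
  infClosed' := by
    intro U hU V hV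
    rw [mem_ofPred_eq, orthProj_inf_of_commute (hR _ hU _ hV)]
    exact mul_mem hU hV
  bot_mem' := by simpa only [mem_ofPred_eq, orthProj_bot] using zero_mem R
  top_mem' := by simpa only [mem_ofPred_eq, orthProj_top] using one_mem R
  orthogonal_mem' U hU := by
    rw [mem_ofPred_eq, orthProj_orthogonal]
    exact sub_mem (one_mem R) hU

theorem OrthoSublattice.isDistributive_ofCommutative (R : Subring (H →L[ℂ] H))
    (hR : ∀ x ∈ R, ∀ y ∈ R, x * y = y * x) : (ofCommutative R hR).IsDistributive := by
  have h1 : ∀ U V W : ofCommutative R hR, U ⊓ (V ⊔ W) = (U ⊓ V) ⊔ (U ⊓ W) := by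
    intro U V W
    apply Subtype.ext
    apply orthProj_injective
    have inf (U V : ofCommutative R hR) :
        orthProj (U ⊓ V : ofCommutative R hR).1 = orthProj U.1 * orthProj V.1 :=
      orthProj_inf_of_commute (hR _ U.2 _ V.2)
    have sup (U V : ofCommutative R hR) :
        orthProj (U ⊔ V : ofCommutative R hR).1 =
          orthProj U.1 + orthProj V.1 - orthProj U.1 * orthProj V.1 :=
      orthProj_sup_of_commute (hR _ U.2 _ V.2)
    have e : orthProj U.1 * orthProj V.1 * (orthProj U.1 * orthProj W.1) =
        orthProj U.1 * (orthProj V.1 * orthProj W.1) := by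
      rw [hR _ U.2 _ V.2, mul_assoc, ← mul_assoc (orthProj U.1), orthProj_mul_self, ← mul_assoc,
        ← hR _ U.2 _ V.2, mul_assoc]
    rw [inf, sup, sup, inf, inf, e, mul_sub, mul_add]
  refine ⟨h1, fun U V W => ?_⟩
  let _ : DistribLattice (ofCommutative R hR) :=
    DistribLattice.ofInfSupLe fun U V W => (h1 U V W).le
  exact sup_inf_left U V W

namespace BooleanSector

/-- By maximality, a Boolean sector contains every closed subspace whose projection commutes with
the projections of the sector: the sector and this subspace generate a distributive lattice. -/
theorem mem_lattice_of_commute (B : BooleanSector H) {V : QuantumLattice H}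
    (hV : ∀ U ∈ B.lattice, orthProj U * orthProj V = orthProj V * orthProj U) :
    V ∈ B.lattice := by
  set S : Set (H →L[ℂ] H) := insert (orthProj V) (orthProj '' (B.lattice : Set (QuantumLattice H)))
  have hS : S ⊆ Set.centralizer S := by
    rintro a (rfl | ⟨U, hU, rfl⟩) b (rfl | ⟨W, hW, rfl⟩)
    · rfl
    · exact hV W hW
    · exact (hV U hU).symm
    · exact B.orthProj_comm hW hU
  set R : Subring (H →L[ℂ] H) := Subring.centralizer (Set.centralizer S)
  have hR : ∀ x ∈ R, ∀ y ∈ R, x * y = y * x := by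
    intro x hx y hy
    have hx' : x ∈ Set.centralizer S := Set.centralizer_subset hS hx
    exact hy x hx'
  have hSR : S ⊆ R := Set.subset_centralizer_centralizer
  have hle : B.lattice ≤ OrthoSublattice.ofCommutative R hR := fun U hU =>
    hSR (Or.inr ⟨U, hU, rfl⟩)
  exact B.maximal'.2 (OrthoSublattice.isDistributive_ofCommutative R hR) hle
    (hSR (Or.inl rfl) : orthProj V ∈ R)

theorem commute_proj (B : BooleanSector H) (a : B.cstar) {U : QuantumLattice H}
    (hU : U ∈ B.lattice) : Commute (a : H →L[ℂ] H) (orthProj U) :=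
  congrArg Subtype.val (B.cstar_comm a (B.proj ⟨U, hU⟩))

end BooleanSector

end Projections

/-! ### Characters of commutative C⋆-algebras -/

section Characters

open WeakDual

variable {A : Type*} [CommCStarAlgebra A]

theorem norm_le_of_forall_character {a : A} {C : ℝ} (hC : 0 ≤ C)
    (h : ∀ τ : characterSpace ℂ A, ‖τ a‖ ≤ C) : ‖a‖ ≤ C := by
  have := (gelfandTransform_isometry A).norm_map_of_map_zero (map_zero _) a
  rw [← this, ContinuousMap.norm_le _ hC]
  exact h

theorem eq_of_forall_character {a b : A} (h : ∀ τ : characterSpace ℂ A, τ a = τ b) : a = b :=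
  (gelfandTransform_isometry A).injective (ContinuousMap.ext h)

theorem character_eq_ofReal_re (τ : characterSpace ℂ A) {a : A} (ha : IsSelfAdjoint a) :
    τ a = ((τ a).re : ℂ) :=
  (Complex.conj_eq_iff_re.1 (ha.map τ).star_eq).symm

theorem abs_re_character_le (τ : characterSpace ℂ A) (a : A) : |(τ a).re| ≤ ‖a‖ :=
  calc |(τ a).re| ≤ ‖gelfandTransform ℂ A a τ‖ := Complex.abs_re_le_norm _
    _ ≤ ‖gelfandTransform ℂ A a‖ := ContinuousMap.norm_coe_le_norm _ τ
    _ = ‖a‖ := (gelfandTransform_isometry A).norm_map_of_map_zero (map_zero _) a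

/-- Characters intertwine the continuous functional calculus with the evaluation of functions. -/
theorem character_cfc (τ : characterSpace ℂ A) {a : A} (ha : IsSelfAdjoint a) {f : ℝ → ℝ}
    (hf : Continuous f) : τ (cfc f a) = (f (τ a).re : ℂ) := by
  have h := StarAlgHomClass.map_cfc (S := ℂ) (q := IsSelfAdjoint) τ f a hf.continuousOn
    (map_continuous τ) ha (ha.map τ)
  rw [h, character_eq_ofReal_re τ ha, Complex.ofReal_re]
  exact cfc_algebraMap (A := ℂ) (τ a).re f

end Characters

/-! ### Quasipoints and characters -/

/-- Comparable quasipoints are equal, by maximality. -/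
theorem Quasipoint.ext_of_le {L : Type*} [Lattice L] [BoundedOrder L] {β γ : Quasipoint L}
    (h : ∀ U ∈ β, U ∈ γ) : β = γ := by
  obtain ⟨b, hb⟩ := β
  obtain ⟨c, hc⟩ := γ
  have : b = c := hb.eq_of_subset hc.1 h
  subst this
  rfl

namespace BooleanSector

open WeakDual

variable {H : Type*} [NormedAddCommGroup H] [InnerProductSpace ℂ H] [CompleteSpace H]
  (B : BooleanSector H)

theorem proj_mul_self (U : B) : B.proj U * B.proj U = B.proj U :=
  Subtype.ext (orthProj_mul_self U.1)

theorem isSelfAdjoint_proj (U : B) : IsSelfAdjoint (B.proj U) :=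
  Subtype.ext (isSelfAdjoint_orthProj U.1)

theorem proj_top : B.proj ⊤ = 1 := Subtype.ext orthProj_top

theorem proj_bot : B.proj ⊥ = 0 := Subtype.ext orthProj_bot

theorem proj_inf (U V : B) : B.proj (U ⊓ V) = B.proj U * B.proj V :=
  Subtype.ext (orthProj_inf_of_commute (B.orthProj_comm U.2 V.2))

/-- The orthogonal complement in a Boolean sector. -/
def compl (U : B) : B := ⟨U.1.orthogonal, B.lattice.orthogonal_mem' U.1 U.2⟩

theorem proj_compl (U : B) : B.proj (B.compl U) = 1 - B.proj U :=
  Subtype.ext (orthProj_orthogonal U.1)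

theorem proj_injective : Function.Injective B.proj := fun _ _ h =>
  Subtype.ext (orthProj_injective (congrArg Subtype.val h))

variable {B}

theorem character_proj (τ : characterSpace ℂ B.cstar) (U : B) :
    τ (B.proj U) = 0 ∨ τ (B.proj U) = 1 := by
  have h := congrArg τ (B.proj_mul_self U)
  rw [map_mul] at h
  exact (IsIdempotentElem.iff_eq_zero_or_one (p := τ (B.proj U))).1 h

theorem character_proj_compl (τ : characterSpace ℂ B.cstar) (U : B) :
    τ (B.proj (B.compl U)) = 1 - τ (B.proj U) := by
  rw [proj_compl, map_sub, map_one]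

theorem character_proj_of_le (τ : characterSpace ℂ B.cstar) {U V : B} (h : U ≤ V)
    (hU : τ (B.proj U) = 1) : τ (B.proj V) = 1 := by
  have := B.proj_inf U V
  rw [inf_eq_left.2 h] at this
  have := congrArg τ this
  rwa [map_mul, hU, one_mul, eq_comm] at this

/-- A character of the C⋆-algebra is determined by its values on the projections. -/
theorem character_ext {τ τ' : characterSpace ℂ B.cstar}
    (h : ∀ U, τ (B.proj U) = τ' (B.proj U)) : τ = τ' := by
  have key : (τ : B.cstar →⋆ₐ[ℂ] ℂ) = (τ' : B.cstar →⋆ₐ[ℂ] ℂ) := by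
    refine StarAlgHom.ext_topologicalClosure (map_continuous τ) (map_continuous τ') ?_
    refine StarAlgHom.ext_adjoin ?_
    rintro ⟨_, _⟩ ⟨U, hU, rfl⟩
    exact h ⟨U, hU⟩
  exact CharacterSpace.ext fun x => DFunLike.congr_fun key x

/-- If the projection onto `U` is nonzero, the C⋆-property provides a character not vanishing
on it. -/
theorem exists_character_proj_eq_one {U : B} (hU : U ≠ ⊥) :
    ∃ τ : characterSpace ℂ B.cstar, τ (B.proj U) = 1 := by
  by_contra! h
  refine hU (B.proj_injective (eq_of_forall_character fun τ => ?_))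
  rw [proj_bot, map_zero]
  exact (character_proj τ U).resolve_right (h τ)

/-- The quasipoint of a character `τ`: all `U` with `τ (P_U) = 1`. -/
def quasipointOfCharacter (τ : characterSpace ℂ B.cstar) : Quasipoint B where
  carrier := {U | τ (B.proj U) = 1}
  maximal' := by
    refine ⟨⟨⟨⊤, ?_⟩, ?_, ?_⟩, ?_⟩
    · rw [mem_ofPred_eq, proj_top, map_one]
    · rw [mem_ofPred_eq, proj_bot, map_zero]
      exact zero_ne_one
    · intro U hU V hV
      refine ⟨U ⊓ V, ?_, le_rfl⟩
      rw [mem_ofPred_eq, proj_inf, map_mul, hU, hV, one_mul]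
    · intro b hb hle U hU
      refine (character_proj τ U).resolve_left fun h0 => hb.bot_notMem ?_
      have hc : B.compl U ∈ b := hle <| by
        show τ _ = 1
        rw [character_proj_compl, h0, sub_zero]
      obtain ⟨z, hz, hzle⟩ := hb.directed U hU _ hc
      have hbot : U ⊓ B.compl U = ⊥ := B.proj_injective <| by
        rw [proj_inf, proj_compl, mul_sub, mul_one, proj_mul_self, sub_self, proj_bot]
      rwa [← le_bot_iff.1 (hzle.trans hbot.le)]

theorem mem_quasipointOfCharacter {τ : characterSpace ℂ B.cstar} {U : B} :
    U ∈ quasipointOfCharacter τ ↔ τ (B.proj U) = 1 := Iff.rfl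

theorem quasipointOfCharacter_injective :
    Function.Injective (quasipointOfCharacter (B := B)) := by
  intro τ τ' h
  refine character_ext fun U => ?_
  have hU : τ (B.proj U) = 1 ↔ τ' (B.proj U) = 1 := by
    rw [← mem_quasipointOfCharacter, h, mem_quasipointOfCharacter]
  rcases character_proj τ U with h0 | h1
  · rw [h0, (character_proj τ' U).resolve_right fun h1 => zero_ne_one (h0.symm.trans (hU.2 h1))]
  · rw [h1, hU.1 h1]

/-- By compactness of the spectrum, every quasipoint is the quasipoint of a character: the closed
sets `{τ | τ (P_U) = 1}` for `U ∈ β` are nonempty and directed. -/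
theorem quasipointOfCharacter_surjective :
    Function.Surjective (quasipointOfCharacter (B := B)) := by
  intro β
  have hβ := β.maximal'.1
  have := hβ.nonempty.to_subtype
  have hcl : ∀ U : β.carrier, IsClosed {τ : characterSpace ℂ B.cstar | τ (B.proj U) = 1} :=
    fun U => isClosed_eq ((map_continuous (gelfandTransform ℂ B.cstar (B.proj U)))) continuous_const
  obtain ⟨τ, hτ⟩ := IsCompact.nonempty_iInter_of_directed_nonempty_isCompact_isClosed
    (fun U : β.carrier => {τ : characterSpace ℂ B.cstar | τ (B.proj U) = 1})
    (by
      intro U V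
      obtain ⟨W, hW, hle⟩ := hβ.directed U U.2 V V.2
      exact ⟨⟨W, hW⟩, fun τ hτ => character_proj_of_le τ (hle.trans inf_le_left) hτ,
        fun τ hτ => character_proj_of_le τ (hle.trans inf_le_right) hτ⟩)
    (fun U => exists_character_proj_eq_one fun h => hβ.bot_notMem (h ▸ U.2))
    (fun U => (hcl U).isCompact) hcl
  exact ⟨τ, (Quasipoint.ext_of_le fun U hU => mem_iInter.1 hτ ⟨U, hU⟩).symm⟩

theorem continuous_quasipointOfCharacter : Continuous (quasipointOfCharacter (B := B)) := by
  refine continuous_generateFrom_iff.2 ?_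
  rintro _ ⟨U, rfl⟩
  have : quasipointOfCharacter ⁻¹' Quasipoint.basicOpen U =
      {τ : characterSpace ℂ B.cstar | τ (B.proj U) ≠ 0} := by
    ext τ
    change τ (B.proj U) = 1 ↔ τ (B.proj U) ≠ 0
    rcases character_proj τ U with h | h <;> simp [h]
  rw [this]
  exact isOpen_ne_fun (map_continuous (gelfandTransform ℂ B.cstar (B.proj U))) continuous_const

/-- Distinct quasipoints are separated by some `U` of the sector and its complement. -/
instance : T2Space (Quasipoint B) where
  t2 β γ hne := by
    obtain ⟨U, hβ, hγ⟩ : ∃ U ∈ β, U ∉ γ := by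
      by_contra! h
      exact hne (Quasipoint.ext_of_le h)
    obtain ⟨τ, rfl⟩ := quasipointOfCharacter_surjective γ
    refine ⟨Quasipoint.basicOpen U, Quasipoint.basicOpen (B.compl U), .basic _ ⟨U, rfl⟩,
      .basic _ ⟨_, rfl⟩, hβ, ?_, ?_⟩
    · change τ _ = 1
      rw [character_proj_compl, (character_proj τ U).resolve_right hγ, sub_zero]
    · rw [Set.disjoint_left]
      intro δ hδ hδ'
      obtain ⟨τ', rfl⟩ := quasipointOfCharacter_surjective δ
      have h1 : τ' (B.proj U) = 1 := hδ
      have h2 : τ' (B.proj (B.compl U)) = 1 := hδ'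
      rw [character_proj_compl, h1, sub_self] at h2
      exact zero_ne_one h2

variable (B) in
/-- The identification of the Stonean space of a Boolean sector with the Gelfand spectrum of its
C⋆-algebra. -/
def quasipointHomeomorph : Quasipoint B ≃ₜ characterSpace ℂ B.cstar :=
  let e : characterSpace ℂ B.cstar ≃ Quasipoint B := Equiv.ofBijective quasipointOfCharacter
    ⟨quasipointOfCharacter_injective, quasipointOfCharacter_surjective⟩
  have he : Continuous e := continuous_quasipointOfCharacter
  he.homeoOfEquivCompactToT2.symm

theorem isCanonical_quasipointHomeomorph : B.IsCanonical B.quasipointHomeomorph := by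
  intro β U
  obtain ⟨τ, rfl⟩ := B.quasipointHomeomorph.symm.surjective β
  rw [Homeomorph.apply_symm_apply]
  exact ⟨id, (character_proj τ U).resolve_right⟩

theorem IsCanonical.eq {τ τ' : Quasipoint B ≃ₜ characterSpace ℂ B.cstar} (h : B.IsCanonical τ)
    (h' : B.IsCanonical τ') : τ = τ' := by
  refine Homeomorph.ext fun β => character_ext fun U => ?_
  by_cases hU : U ∈ β
  · rw [(h β U).1 hU, (h' β U).1 hU]
  · rw [(h β U).2 hU, (h' β U).2 hU]

end BooleanSector

/-! ### Riemann–Stieltjes sums and uniqueness of the spectral family -/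

section Sums

/-- Only the intervals at which `m` increases contribute to a Riemann–Stieltjes sum. -/
theorem sum_mul_increment_le {m ξ : ℕ → ℝ} {n : ℕ} {c : ℝ} (hm : ∀ k, m k ≤ m (k + 1))
    (h : ∀ k < n, m k ≠ m (k + 1) → ξ k ≤ c) :
    ∑ k ∈ Finset.range n, ξ k * (m (k + 1) - m k) ≤ c * (m n - m 0) := by
  rw [← Finset.sum_range_sub, Finset.mul_sum]
  refine Finset.sum_le_sum fun k hk => ?_
  by_cases hk' : m k = m (k + 1)
  · simp [hk']
  · exact mul_le_mul_of_nonneg_right (h k (Finset.mem_range.1 hk) hk') (sub_nonneg.2 (hm k))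

/-- Only the intervals at which `m` increases contribute to a Riemann–Stieltjes sum. -/
theorem le_sum_mul_increment {m ξ : ℕ → ℝ} {n : ℕ} {c : ℝ} (hm : ∀ k, m k ≤ m (k + 1))
    (h : ∀ k < n, m k ≠ m (k + 1) → c ≤ ξ k) :
    c * (m n - m 0) ≤ ∑ k ∈ Finset.range n, ξ k * (m (k + 1) - m k) := by
  rw [← Finset.sum_range_sub, Finset.mul_sum]
  refine Finset.sum_le_sum fun k hk => ?_
  by_cases hk' : m k = m (k + 1)
  · simp [hk']
  · exact mul_le_mul_of_nonneg_right (h k (Finset.mem_range.1 hk) hk') (sub_nonneg.2 (hm k))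

end Sums

section Operators

variable {H : Type*} [NormedAddCommGroup H] [InnerProductSpace ℂ H] [CompleteSpace H]

/-- The integral is approximated by left Riemann–Stieltjes sums over fine partitions. -/
theorem IsRiemannStieltjesIntegral.exists_left_sum {σ : ℝ → QuantumLattice H} {a b : ℝ}
    {A : H →L[ℂ] H} (h : IsRiemannStieltjesIntegral σ a b A) (hab : a ≤ b) {ε : ℝ} (hε : 0 < ε) :
    ∃ (n : ℕ) (t : ℕ → ℝ), Monotone t ∧ t 0 = a ∧ t n = b ∧ (∀ k, t (k + 1) - t k ≤ ε) ∧
      ‖A - ∑ k ∈ Finset.range n,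
        (t k : ℂ) • (orthProj (σ (t (k + 1))) - orthProj (σ (t k)))‖ < ε := by
  obtain ⟨δ, hδ, hI⟩ := h ε hε
  obtain ⟨n, hn⟩ := exists_nat_gt ((b - a) / min δ ε)
  have hmin : 0 < min δ ε := lt_min hδ hε
  have hn0 : (0 : ℝ) < n := lt_of_le_of_lt (div_nonneg (sub_nonneg.2 hab) hmin.le) hn
  have hstep : (b - a) / n < min δ ε := by
    rw [div_lt_iff₀ hmin] at hn
    rw [div_lt_iff₀ hn0]
    linarith
  have hstep0 : 0 ≤ (b - a) / n := div_nonneg (sub_nonneg.2 hab) hn0.le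
  have hdiff : ∀ k : ℕ, (a + ((k + 1 : ℕ) : ℝ) * ((b - a) / n)) - (a + (k : ℝ) * ((b - a) / n)) =
      (b - a) / n := by
    intro k
    push_cast
    ring
  have hmono : Monotone fun k : ℕ => a + (k : ℝ) * ((b - a) / n) :=
    monotone_nat_of_le_succ fun k => by
      have := hdiff k
      linarith
  have hlast : a + (n : ℝ) * ((b - a) / n) = b := by
    field_simp
    ring
  have hfirst : a + ((0 : ℕ) : ℝ) * ((b - a) / n) = a := by simp
  generalize (b - a) / (n : ℝ) = d at *
  refine ⟨n, fun k => a + (k : ℝ) * d, hmono, hfirst, hlast, fun k => ?_, ?_⟩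
  · exact (hdiff k).trans_le (hstep.trans_le (min_le_right _ _)).le
  · exact hI n (fun k => a + (k : ℝ) * d) (fun k => a + (k : ℝ) * d) hmono hfirst hlast
      (fun k _ => (hdiff k).trans_lt (hstep.trans_le (min_le_left _ _)))
      fun k _ => ⟨le_rfl, hmono k.le_succ⟩

namespace IsSpectralFamilyOf

variable {σ : ℝ → QuantumLattice H} {A : H →L[ℂ] H}

/-- An operator commutes with the projections of its spectral family, as its Riemann–Stieltjes sums
do. -/
theorem commute_orthProj (h : IsSpectralFamilyOf σ A) (s : ℝ) : Commute (orthProj (σ s)) A := by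
  obtain ⟨hσ, a, b, hab, -, -, hI⟩ := h
  have hA : A ∈ closure (Set.centralizer {orthProj (σ s)}) := by
    refine Metric.mem_closure_iff.2 fun ε hε => ?_
    obtain ⟨n, t, -, -, -, -, hlt⟩ := hI.exists_left_sum hab hε
    refine ⟨_, ?_, by rwa [dist_eq_norm]⟩
    change _ ∈ Subalgebra.centralizer ℂ {orthProj (σ s)}
    refine sum_mem fun k _ => Subalgebra.smul_mem _ (sub_mem ?_ ?_) _
    all_goals
      rintro _ rfl
      exact orthProj_commute_of_monotone hσ.mono _ _
  rw [(Set.isClosed_centralizer _).closure_eq] at hA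
  exact hA _ rfl

/-- Left Riemann–Stieltjes sums for `⟪x, A x⟫`, in terms of the distribution function
`t ↦ ‖P_{σ t} x‖ ^ 2`. -/
theorem exists_sum_norm_sq (h : IsSpectralFamilyOf σ A) (x : H) {ε : ℝ} (hε : 0 < ε) :
    ∃ (n : ℕ) (t : ℕ → ℝ), Monotone t ∧ (∀ k, t (k + 1) - t k ≤ ε) ∧
      ‖orthProj (σ (t 0)) x‖ ^ 2 = 0 ∧ ‖orthProj (σ (t n)) x‖ ^ 2 = ‖x‖ ^ 2 ∧
      |(inner ℂ x (A x)).re - ∑ k ∈ Finset.range n,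
        t k * (‖orthProj (σ (t (k + 1))) x‖ ^ 2 - ‖orthProj (σ (t k)) x‖ ^ 2)| ≤ ε * ‖x‖ ^ 2 := by
  obtain ⟨hσ, a, b, hab, ha, hb, hI⟩ := h
  obtain ⟨n, t, htm, ht0, htn, hts, hlt⟩ := hI.exists_left_sum hab hε
  refine ⟨n, t, htm, hts, by simp [ht0, ha, orthProj_bot], by simp [htn, hb, orthProj_top], ?_⟩
  have key : (inner ℂ x ((A - ∑ k ∈ Finset.range n,
        (t k : ℂ) • (orthProj (σ (t (k + 1))) - orthProj (σ (t k)))) x)).re =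
      (inner ℂ x (A x)).re - ∑ k ∈ Finset.range n,
        t k * (‖orthProj (σ (t (k + 1))) x‖ ^ 2 - ‖orthProj (σ (t k)) x‖ ^ 2) := by
    simp only [sub_apply, sum_apply, smul_apply, inner_sub_right, inner_sum, inner_smul_right,
      Complex.sub_re, Complex.re_sum, Complex.re_ofReal_mul, re_inner_orthProj]
  rw [← key]
  calc _ ≤ ‖inner ℂ x ((A - ∑ k ∈ Finset.range n,
        (t k : ℂ) • (orthProj (σ (t (k + 1))) - orthProj (σ (t k)))) x)‖ := Complex.abs_re_le_norm _
    _ ≤ ‖x‖ * (ε * ‖x‖) := (norm_inner_le_norm _ _).trans <|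
        mul_le_mul_of_nonneg_left (ContinuousLinearMap.le_of_opNorm_le _ hlt.le x) (norm_nonneg x)
    _ = ε * ‖x‖ ^ 2 := by ring

theorem re_inner_le (h : IsSpectralFamilyOf σ A) {s : ℝ} {x : H} (hx : x ∈ σ s) :
    (inner ℂ x (A x)).re ≤ s * ‖x‖ ^ 2 := by
  have hmono := h.1.mono
  refine le_of_forall_pos_le_add fun η hη => ?_
  have hx2 : 0 < ‖x‖ ^ 2 + 1 := by positivity
  obtain ⟨n, t, htm, -, h0, hn, hsum⟩ := h.exists_sum_norm_sq x (div_pos hη hx2)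
  have hle := sum_mul_increment_le (m := fun k => ‖orthProj (σ (t k)) x‖ ^ 2) (ξ := t) (n := n)
    (c := s) (fun k => pow_le_pow_left₀ (norm_nonneg _)
      (norm_orthProj_apply_le_of_le (hmono (htm k.le_succ)) x) 2) (fun k _ hk => by
      by_contra! hlt
      -- beyond `s` the distribution function of `x` is constant
      refine hk ?_
      simp only [orthProj_eq_self_iff.2 (hmono hlt.le hx),
        orthProj_eq_self_iff.2 (hmono (hlt.le.trans (htm k.le_succ)) hx)])
  simp only [h0, hn, sub_zero] at hle
  have hη' : η / (‖x‖ ^ 2 + 1) * ‖x‖ ^ 2 ≤ η := by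
    rw [div_mul_eq_mul_div, div_le_iff₀ hx2]
    nlinarith
  have := (abs_le.1 hsum).2
  linarith

theorem le_re_inner (h : IsSpectralFamilyOf σ A) {s : ℝ} {x : H} (hx : orthProj (σ s) x = 0) :
    s * ‖x‖ ^ 2 ≤ (inner ℂ x (A x)).re := by
  have hmono := h.1.mono
  have hzero : ∀ r ≤ s, orthProj (σ r) x = 0 := fun r hr => by
    rw [← norm_le_zero_iff]
    exact (norm_orthProj_apply_le_of_le (hmono hr) x).trans (by rw [hx, norm_zero])
  refine le_of_forall_pos_le_add fun η hη => ?_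
  have hx2 : 0 < 2 * ‖x‖ ^ 2 + 1 := by positivity
  obtain ⟨n, t, htm, hts, h0, hn, hsum⟩ := h.exists_sum_norm_sq x (div_pos hη hx2)
  have hle := le_sum_mul_increment (m := fun k => ‖orthProj (σ (t k)) x‖ ^ 2) (ξ := t) (n := n)
    (c := s - η / (2 * ‖x‖ ^ 2 + 1)) (fun k => pow_le_pow_left₀ (norm_nonneg _)
      (norm_orthProj_apply_le_of_le (hmono (htm k.le_succ)) x) 2) (fun k _ hk => by
      by_contra! hlt
      -- up to `s` the distribution function of `x` vanishes
      refine hk ?_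
      have := hts k
      simp only [hzero (t k) (by linarith [htm k.le_succ]), hzero (t (k + 1)) (by linarith)])
  simp only [h0, hn, sub_zero] at hle
  have hη' : 2 * (η / (2 * ‖x‖ ^ 2 + 1) * ‖x‖ ^ 2) ≤ η := by
    rw [div_mul_eq_mul_div, ← mul_div_assoc, div_le_iff₀ hx2]
    nlinarith
  have := (abs_le.1 hsum).1
  linarith

/-- On `σ s ⊓ (σ' t)ᗮ` the quadratic form of `A` is at most `s` and at least `t`, so this
subspace is zero for `s < t`. -/
theorem le_of_commute_of_lt {σ' : ℝ → QuantumLattice H} (h : IsSpectralFamilyOf σ A)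
    (h' : IsSpectralFamilyOf σ' A) {s t : ℝ} (hst : s < t)
    (hc : Commute (orthProj (σ s)) (orthProj (σ' t))) : σ s ≤ σ' t := by
  intro x hx
  set y := x - orthProj (σ' t) x with hy
  have hyσ : y ∈ σ s := by
    refine (σ s).toSubmodule.sub_mem hx (orthProj_eq_self_iff.1 ?_)
    have := congrArg (fun T : H →L[ℂ] H => T x) hc.eq
    simpa only [mul_apply_eq_comp, orthProj_eq_self_iff.2 hx] using this
  have hyσ' : orthProj (σ' t) y = 0 := by
    rw [hy, map_sub, orthProj_eq_self_iff.2 (orthProj_apply_mem _ x), sub_self]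
  have h1 := h.re_inner_le hyσ
  have h2 := h'.le_re_inner hyσ'
  have hy0 : y = 0 := by
    have : ‖y‖ ^ 2 ≤ 0 := by nlinarith [sq_nonneg ‖y‖]
    exact norm_eq_zero.1 (pow_eq_zero_iff two_ne_zero |>.1 (le_antisymm this (sq_nonneg _)))
  rw [← orthProj_eq_self_iff, eq_comm]
  exact sub_eq_zero.1 hy0

/-- Two spectral families of the same operator agree if they commute with each other. -/
theorem eq_of_commute {σ' : ℝ → QuantumLattice H} (h : IsSpectralFamilyOf σ A)
    (h' : IsSpectralFamilyOf σ' A)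
    (hc : ∀ s t, Commute (orthProj (σ s)) (orthProj (σ' t))) : σ = σ' := by
  funext s
  refine le_antisymm ?_ ?_
  · rw [h'.1.right_cont]
    exact le_iInf₂ fun t hst => h.le_of_commute_of_lt h' hst (hc s t)
  · rw [h.1.right_cont]
    exact le_iInf₂ fun t hst => h'.le_of_commute_of_lt h hst (hc t s).symm

end IsSpectralFamilyOf

end Operators

/-! ### Spectral families from the functional calculus -/

section LowerSpectralSubspace

variable {H : Type*} [NormedAddCommGroup H] [InnerProductSpace ℂ H] [CompleteSpace H]

/-- The spectral subspace of `A` for `(-∞, t]`, namely the kernel of the positive part of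
`A - t`. -/
def lowerSpectralSubspace (A : H →L[ℂ] H) (t : ℝ) : QuantumLattice H :=
  (⊥ : QuantumLattice H).comap (cfc (fun x : ℝ => max (x - t) 0) A)

theorem mem_lowerSpectralSubspace {A : H →L[ℂ] H} {t : ℝ} {x : H} :
    x ∈ lowerSpectralSubspace A t ↔ cfc (fun x : ℝ => max (x - t) 0) A x = 0 := Iff.rfl

theorem commute_orthProj_lowerSpectralSubspace {A T : H →L[ℂ] H} (hT : IsSelfAdjoint T)
    (h : Commute T A) (t : ℝ) : Commute T (orthProj (lowerSpectralSubspace A t)) := by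
  refine commute_orthProj_of_isSelfAdjoint hT fun x hx => ?_
  have hc : Commute (cfc (fun x : ℝ => max (x - t) 0) A) T := h.symm.cfc_real _
  have := congrArg (fun S : H →L[ℂ] H => S x) hc.eq
  simp only [mul_apply_eq_comp, mem_lowerSpectralSubspace.1 hx, map_zero] at this
  exact this

namespace BooleanSector

open WeakDual

variable (B : BooleanSector H)

theorem lowerSpectralSubspace_mem (A : B.cstar) (t : ℝ) :
    lowerSpectralSubspace (A : H →L[ℂ] H) t ∈ B.lattice :=
  B.mem_lattice_of_commute fun U hU =>
    commute_orthProj_lowerSpectralSubspace (isSelfAdjoint_orthProj U) (B.commute_proj A hU).symm t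

/-- The spectral subspace of `A` for `(-∞, t]`, as an element of the Boolean sector. -/
def spectralSubspace (A : B.cstar) (t : ℝ) : B :=
  ⟨lowerSpectralSubspace (A : H →L[ℂ] H) t, B.lowerSpectralSubspace_mem A t⟩

variable {B} {A : B.cstar}

theorem coe_cfc (hA : IsSelfAdjoint A) {f : ℝ → ℝ} (hf : Continuous f) :
    ((cfc f A : B.cstar) : H →L[ℂ] H) = cfc f (A : H →L[ℂ] H) :=
  StarAlgHom.map_cfc B.cstar.subtype f A hf.continuousOn continuous_subtype_val hA
    (hA.map B.cstar.subtype)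

theorem continuous_truncation (t : ℝ) : Continuous fun x : ℝ => max (x - t) 0 := by fun_prop

theorem mem_spectralSubspace (hA : IsSelfAdjoint A) {t : ℝ} {x : H} :
    x ∈ (B.spectralSubspace A t).1 ↔
      ((cfc (fun x : ℝ => max (x - t) 0) A : B.cstar) : H →L[ℂ] H) x = 0 := by
  rw [coe_cfc hA (continuous_truncation t)]
  exact mem_lowerSpectralSubspace

theorem truncation_mul_proj (hA : IsSelfAdjoint A) (t : ℝ) :
    cfc (fun x : ℝ => max (x - t) 0) A * B.proj (B.spectralSubspace A t) = 0 := by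
  apply Subtype.ext
  ext x
  exact (mem_spectralSubspace hA).1 (orthProj_apply_mem _ x)

theorem re_character_le (hA : IsSelfAdjoint A) {τ : characterSpace ℂ B.cstar} {t : ℝ}
    (h : τ (B.proj (B.spectralSubspace A t)) = 1) : (τ A).re ≤ t := by
  have := congrArg τ (truncation_mul_proj hA t)
  rw [map_mul, h, mul_one, map_zero, character_cfc τ hA (continuous_truncation t),
    Complex.ofReal_eq_zero] at this
  linarith [le_max_left ((τ A).re - t) 0]

/-- The negative part of `A - t` maps into the kernel of the positive part. -/
theorem le_re_character (hA : IsSelfAdjoint A) {τ : characterSpace ℂ B.cstar} {t : ℝ}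
    (h : τ (B.proj (B.spectralSubspace A t)) = 0) : t ≤ (τ A).re := by
  have hcont : Continuous fun x : ℝ => max (t - x) 0 := by fun_prop
  have h0 : cfc (fun x : ℝ => max (x - t) 0) A * cfc (fun x : ℝ => max (t - x) 0) A = 0 := by
    refine eq_of_forall_character fun τ => ?_
    rw [map_mul, character_cfc τ hA (continuous_truncation t), character_cfc τ hA hcont, map_zero,
      ← Complex.ofReal_mul, Complex.ofReal_eq_zero, mul_eq_zero]
    rcases le_total (τ A).re t with h | h
    · exact Or.inl (max_eq_right (sub_nonpos.2 h))
    · exact Or.inr (max_eq_right (sub_nonpos.2 h))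
  have h1 : B.proj (B.spectralSubspace A t) * cfc (fun x : ℝ => max (t - x) 0) A =
      cfc (fun x : ℝ => max (t - x) 0) A := by
    apply Subtype.ext
    ext x
    refine orthProj_eq_self_iff.2 ((mem_spectralSubspace hA).2 ?_)
    exact congrArg (fun S : B.cstar => (S : H →L[ℂ] H) x) h0
  have := congrArg τ h1
  rw [map_mul, h, zero_mul, character_cfc τ hA hcont, eq_comm, Complex.ofReal_eq_zero] at this
  linarith [le_max_left (t - (τ A).re) 0]

theorem character_spectralSubspace_of_lt (hA : IsSelfAdjoint A) {τ : characterSpace ℂ B.cstar}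
    {t : ℝ} (h : (τ A).re < t) : τ (B.proj (B.spectralSubspace A t)) = 1 :=
  (character_proj τ _).resolve_left fun h0 => h.not_ge (le_re_character hA h0)

theorem character_spectralSubspace_of_gt (hA : IsSelfAdjoint A) {τ : characterSpace ℂ B.cstar}
    {t : ℝ} (h : t < (τ A).re) : τ (B.proj (B.spectralSubspace A t)) = 0 :=
  (character_proj τ _).resolve_right fun h1 => h.not_ge (re_character_le hA h1)

theorem spectralSubspace_eq_bot (hA : IsSelfAdjoint A) {t : ℝ} (ht : t < -‖A‖) :
    B.spectralSubspace A t = ⊥ := by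
  refine B.proj_injective (eq_of_forall_character fun τ => ?_)
  rw [proj_bot, map_zero]
  exact character_spectralSubspace_of_gt hA
    (ht.trans_le (neg_le_of_abs_le (abs_re_character_le τ A)))

theorem spectralSubspace_eq_top (hA : IsSelfAdjoint A) {t : ℝ} (ht : ‖A‖ < t) :
    B.spectralSubspace A t = ⊤ := by
  refine B.proj_injective (eq_of_forall_character fun τ => ?_)
  rw [proj_top, map_one]
  exact character_spectralSubspace_of_lt hA ((le_of_abs_le (abs_re_character_le τ A)).trans_lt ht)

/-- For a vector in the spectral subspace for `(-∞, s]`, the positive part of `A - t` is bounded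
by `s - t`. -/
theorem norm_truncation_apply_le (hA : IsSelfAdjoint A) {s t : ℝ} {x : H}
    (hx : x ∈ lowerSpectralSubspace (A : H →L[ℂ] H) s) :
    ‖((cfc (fun x : ℝ => max (x - t) 0) A : B.cstar) : H →L[ℂ] H) x‖ ≤ max (s - t) 0 * ‖x‖ := by
  have hn : ‖cfc (fun x : ℝ => max (x - t) 0) A * B.proj (B.spectralSubspace A s)‖ ≤
      max (s - t) 0 := by
    refine norm_le_of_forall_character (le_max_right _ _) fun τ => ?_
    rw [map_mul, character_cfc τ hA (continuous_truncation t)]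
    rcases character_proj τ (B.spectralSubspace A s) with h | h
    · simp [h]
    · rw [h, mul_one, Complex.norm_real, Real.norm_of_nonneg (le_max_right _ _)]
      exact max_le_max (sub_le_sub_right (re_character_le hA h) t) le_rfl
  have := ContinuousLinearMap.le_of_opNorm_le _ hn x
  have hP : orthProj (lowerSpectralSubspace (A : H →L[ℂ] H) s) x = x := orthProj_eq_self_iff.2 hx
  have e : ((cfc (fun x : ℝ => max (x - t) 0) A * B.proj (B.spectralSubspace A s) : B.cstar) :
      H →L[ℂ] H) x = ((cfc (fun x : ℝ => max (x - t) 0) A : B.cstar) : H →L[ℂ] H) x :=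
    congrArg _ hP
  rw [← e]
  exact this

theorem isSpectralFamily_lowerSpectralSubspace (hA : IsSelfAdjoint A) :
    IsSpectralFamily (lowerSpectralSubspace (A : H →L[ℂ] H)) := by
  have hmono : Monotone (lowerSpectralSubspace (A : H →L[ℂ] H)) := by
    intro s t hst x hx
    refine (mem_spectralSubspace hA).2 (norm_le_zero_iff.1 ?_)
    have := norm_truncation_apply_le hA (t := t) hx
    rwa [max_eq_right (sub_nonpos.2 hst), zero_mul] at this
  refine ⟨hmono, fun t => le_antisymm (le_iInf₂ fun s hs => hmono hs.le) fun x hx => ?_, ?_, ?_⟩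
  · refine (mem_spectralSubspace hA).2 (norm_le_zero_iff.1 ?_)
    simp only [ClosedSubmodule.mem_iInf] at hx
    have hlim : Tendsto (fun s => max (s - t) 0 * ‖x‖) (𝓝[>] t) (𝓝 (max (t - t) 0 * ‖x‖)) :=
      Continuous.continuousWithinAt (by fun_prop)
    rw [sub_self, max_self, zero_mul] at hlim
    refine ge_of_tendsto hlim ?_
    filter_upwards [self_mem_nhdsWithin] with s hs
    exact norm_truncation_apply_le hA (hx s hs)
  · refine eq_bot_iff.2 (iInf_le_of_le (-‖A‖ - 1) ?_)
    exact (congrArg Subtype.val (spectralSubspace_eq_bot hA (sub_one_lt _))).le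
  · refine eq_top_iff.2 (le_iSup_of_le (‖A‖ + 1) ?_)
    exact (congrArg Subtype.val (spectralSubspace_eq_top hA (lt_add_one _))).ge

/-- Under a character `τ`, a Riemann–Stieltjes sum becomes the tag of the single interval at which
`t ↦ τ (P_{σ t})` jumps from `0` to `1`, and `τ A` lies in this interval. As the C⋆-norm is
computed by the characters, the sums converge in norm. -/
theorem isSpectralFamilyOf_lowerSpectralSubspace (hA : IsSelfAdjoint A) :
    IsSpectralFamilyOf (lowerSpectralSubspace (A : H →L[ℂ] H)) (A : H →L[ℂ] H) := by
  have hbot := spectralSubspace_eq_bot hA (sub_one_lt (-‖A‖))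
  have htop := spectralSubspace_eq_top hA (lt_add_one ‖A‖)
  refine ⟨isSpectralFamily_lowerSpectralSubspace hA, -‖A‖ - 1, ‖A‖ + 1,
    by linarith [norm_nonneg A], congrArg Subtype.val hbot, congrArg Subtype.val htop, ?_⟩
  intro ε hε
  refine ⟨ε / 2, half_pos hε, fun n t ξ htm ht0 htn hts hξ => ?_⟩
  set E : ℝ → B.cstar := fun s => B.proj (B.spectralSubspace A s) with hE
  have key : ‖A - ∑ k ∈ Finset.range n, (ξ k : ℂ) • (E (t (k + 1)) - E (t k))‖ ≤ ε / 2 := by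
    refine norm_le_of_forall_character (half_pos hε).le fun τ => ?_
    have hreal : ∀ s, τ (E s) = ((τ (E s)).re : ℂ) := fun s =>
      character_eq_ofReal_re τ (B.isSelfAdjoint_proj _)
    have h01 : ∀ s, (τ (E s)).re = 0 ∨ (τ (E s)).re = 1 := fun s => by
      rcases character_proj τ (B.spectralSubspace A s) with h | h
      · exact Or.inl (by simp [hE, h])
      · exact Or.inr (by simp [hE, h])
    have hle : ∀ s, (τ (E s)).re = 1 → (τ A).re ≤ s := fun s hs =>
      re_character_le hA ((hreal s).trans (by rw [hs, Complex.ofReal_one]))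
    have hge : ∀ s, (τ (E s)).re = 0 → s ≤ (τ A).re := fun s hs =>
      le_re_character hA ((hreal s).trans (by rw [hs, Complex.ofReal_zero]))
    have hEm : ∀ k, (τ (E (t k))).re ≤ (τ (E (t (k + 1)))).re := fun k => by
      rcases h01 (t k) with h | h
      · rcases h01 (t (k + 1)) with h' | h' <;> norm_num [h, h']
      · have h1 : τ (E (t k)) = 1 := (hreal _).trans (by rw [h, Complex.ofReal_one])
        have hsub : B.spectralSubspace A (t k) ≤ B.spectralSubspace A (t (k + 1)) :=
          (isSpectralFamily_lowerSpectralSubspace hA).mono (htm k.le_succ)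
        have h2 : τ (E (t (k + 1))) = 1 := character_proj_of_le τ hsub h1
        rw [h1, h2]
    have h0 : (τ (E (t 0))).re = 0 := by
      simp only [hE, ht0, hbot, proj_bot, map_zero, Complex.zero_re]
    have hn : (τ (E (t n))).re = 1 := by
      simp only [hE, htn, htop, proj_top, map_one, Complex.one_re]
    have hjump : ∀ k < n, (τ (E (t k))).re ≠ (τ (E (t (k + 1)))).re →
        |(τ A).re - ξ k| ≤ ε / 2 := by
      intro k hk hne
      have hm := hEm k
      have hlow : t k ≤ (τ A).re := hge _ <| (h01 (t k)).resolve_right fun h => by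
        rcases h01 (t (k + 1)) with h' | h'
        · linarith
        · exact hne (h.trans h'.symm)
      have hup : (τ A).re ≤ t (k + 1) := hle _ <| (h01 (t (k + 1))).resolve_left fun h => by
        rcases h01 (t k) with h' | h'
        · exact hne (h'.trans h.symm)
        · linarith
      have h1 := (hξ k hk).1
      have h2 := (hξ k hk).2
      have h3 := hts k hk
      rw [abs_le]
      constructor <;> linarith
    have hupper := sum_mul_increment_le (m := fun k => (τ (E (t k))).re) (ξ := ξ) (n := n)
      (c := (τ A).re + ε / 2) hEm fun k hk hne => by linarith [(abs_le.1 (hjump k hk hne)).1]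
    have hlower := le_sum_mul_increment (m := fun k => (τ (E (t k))).re) (ξ := ξ) (n := n)
      (c := (τ A).re - ε / 2) hEm fun k hk hne => by linarith [(abs_le.1 (hjump k hk hne)).2]
    simp only [h0, hn, sub_zero, mul_one] at hupper hlower
    have hτ : τ (A - ∑ k ∈ Finset.range n, (ξ k : ℂ) • (E (t (k + 1)) - E (t k))) =
        (((τ A).re - ∑ k ∈ Finset.range n,
          ξ k * ((τ (E (t (k + 1)))).re - (τ (E (t k))).re) : ℝ) : ℂ) := by
      rw [map_sub, map_sum, character_eq_ofReal_re τ hA]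
      push_cast
      congr 1
      refine Finset.sum_congr rfl fun k _ => ?_
      rw [map_smul, map_sub, smul_eq_mul, ← hreal, ← hreal]
    rw [hτ, Complex.norm_real, Real.norm_eq_abs, abs_le]
    constructor <;> linarith
  have hcoe : ((A - ∑ k ∈ Finset.range n, (ξ k : ℂ) • (E (t (k + 1)) - E (t k)) : B.cstar) :
      H →L[ℂ] H) = A - ∑ k ∈ Finset.range n, (ξ k : ℂ) •
        (orthProj (lowerSpectralSubspace (A : H →L[ℂ] H) (t (k + 1))) -
          orthProj (lowerSpectralSubspace (A : H →L[ℂ] H) (t k))) := by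
    push_cast
    rfl
  rw [← hcoe]
  exact key.trans_lt (half_lt_self hε)

theorem eq_lowerSpectralSubspace (hA : IsSelfAdjoint A) {σ : ℝ → QuantumLattice H}
    (hσ : IsSpectralFamilyOf σ (A : H →L[ℂ] H)) : σ = lowerSpectralSubspace (A : H →L[ℂ] H) :=
  hσ.eq_of_commute (isSpectralFamilyOf_lowerSpectralSubspace hA) fun s t =>
    commute_orthProj_lowerSpectralSubspace (isSelfAdjoint_orthProj _) (hσ.commute_orthProj s) t

theorem spectralFamily_eq (hA : IsSelfAdjoint A) :
    spectralFamily (A : H →L[ℂ] H) = lowerSpectralSubspace (A : H →L[ℂ] H) := by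
  have h : ∃ σ, IsSpectralFamilyOf σ (A : H →L[ℂ] H) :=
    ⟨_, isSpectralFamilyOf_lowerSpectralSubspace hA⟩
  rw [spectralFamily, dif_pos h]
  exact eq_lowerSpectralSubspace hA h.choose_spec

/-- The subspace `σ_A t` belongs to `β` for `t > τ_β A` and not for `t < τ_β A`. -/
theorem observable_eq_re_character {τ : Quasipoint B ≃ₜ characterSpace ℂ B.cstar}
    (hτ : B.IsCanonical τ) (hA : IsSelfAdjoint A) (β : Quasipoint B) :
    B.observable (A : H →L[ℂ] H) β = (τ β A).re := by
  have hset : {t : ℝ | ∃ h : spectralFamily (A : H →L[ℂ] H) t ∈ B.lattice,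
      (⟨spectralFamily (A : H →L[ℂ] H) t, h⟩ : B.lattice) ∈ β} =
      {t : ℝ | B.spectralSubspace A t ∈ β} := by
    ext t
    rw [spectralFamily_eq hA]
    exact ⟨fun ⟨_, h⟩ => h, fun h => ⟨_, h⟩⟩
  rw [observable, hset]
  refine csInf_eq_of_forall_ge_of_forall_gt_exists_lt ?_ ?_ ?_
  · refine ⟨(τ β A).re + 1, ?_⟩
    by_contra h
    have h1 := character_spectralSubspace_of_lt hA (lt_add_one (τ β A).re)
    exact zero_ne_one (((hτ β _).2 h).symm.trans h1)
  · exact fun t ht => re_character_le hA ((hτ β _).1 ht)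
  · intro w hw
    obtain ⟨t, ht, htw⟩ := exists_between hw
    refine ⟨t, ?_, htw⟩
    by_contra h
    exact zero_ne_one (((hτ β _).2 h).symm.trans (character_spectralSubspace_of_lt hA ht))

end BooleanSector

end LowerSpectralSubspace

end

theorem mainTheorem3 {H : Type*} [NormedAddCommGroup H] [InnerProductSpace ℂ H]
    [CompleteSpace H] (B : BooleanSector H) :
    (∀ A : B.cstar, IsSelfAdjoint A →
      (∃! σ, IsSpectralFamilyOf σ (A : H →L[ℂ] H)) ∧
        Continuous (B.observable (A : H →L[ℂ] H))) ∧
    (∃! τ : Quasipoint B ≃ₜ WeakDual.characterSpace ℂ B.cstar, B.IsCanonical τ) ∧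
    ∀ τ : Quasipoint B ≃ₜ WeakDual.characterSpace ℂ B.cstar, B.IsCanonical τ →
      ∀ A : B.cstar, IsSelfAdjoint A →
        ∀ β : Quasipoint B, B.gelfand τ A β = (B.observable (A : H →L[ℂ] H) β : ℂ) := by
  refine ⟨fun A hA => ⟨⟨_, BooleanSector.isSpectralFamilyOf_lowerSpectralSubspace hA,
    fun σ hσ => BooleanSector.eq_lowerSpectralSubspace hA hσ⟩, ?_⟩,
    ⟨B.quasipointHomeomorph, BooleanSector.isCanonical_quasipointHomeomorph,
      fun τ hτ => hτ.eq BooleanSector.isCanonical_quasipointHomeomorph⟩, fun τ hτ A hA β => ?_⟩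
  · have h : B.observable (A : H →L[ℂ] H) =
        fun β => (WeakDual.gelfandTransform ℂ B.cstar A (B.quasipointHomeomorph β)).re :=
      funext fun β => BooleanSector.observable_eq_re_character
        BooleanSector.isCanonical_quasipointHomeomorph hA β
    rw [h]
    exact Complex.continuous_re.comp
      ((map_continuous _).comp B.quasipointHomeomorph.continuous)
  · rw [BooleanSector.observable_eq_re_character hτ hA β]
    exact character_eq_ofReal_re (τ β) hA
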